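/- Fix a finite universal gate set $S$: for all sufficiently large $m$, every $m$-qubit unitary can be approximated arbitrarily well, up to a global phase, by sequences of gates from $S$. A quantum algorithm is a family of generalized quantum circuits over $S$ (unitary circuits in which some qubits are initialized to zero and some are traced out at the end), and it is QPT if the sizes of its circuits are bounded by a polynomial. A PRS generator with output length $n(\lambda)$ is a QPT algorithm $G$ such that, for all $\lambda$ and $k\in\{0,1\}^\lambda$, $G_\lambda(k)=|\psi_k\rangle\langle\psi_k|$ for some $n(\lambda)$-qubit pure state $|\psi_k\rangle$, and such that for every polynomial $t$ and every non-uniform QPT distinguisher $A$ (with quantum advice) there is a negligible function that bounds, for all $\lambda$, the advantage \[ \mathrm{Adv}_{A,t}(\lambda)=\left|\Pr_{k\leftarrow\{0,1\}^\lambda}\!\left[A_\lambda\big(G_\lambda(k)^{\otimes t(\lambda)}\big)=1\right]-\Pr_{|\vartheta\rangle\leftarrow\mathscr H_{n(\lambda)}}\!\left[A_\lambda\big(|\vartheta\rangle\langle\vartheta|^{\otimes t(\lambda)}\big)=1\right]\right| , \] where $\mathscr H_n$ is the Haar (uniform) probability measure on $n$-qubit unit vectors. Let $n:\mathbb N\to\mathbb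 N$ satisfy $n(\lambda)\ge\log_2\lambda$ for all $\lambda$. 1. For every PRS generator $G$ with output length $n(\lambda)$ there are a polynomial $t$ and a quantum algorithm $A$ (not efficient in general) such that $\mathrm{Adv}_{A,t}(\lambda)\ge\frac13$ for all sufficiently large $\lambda$. 2. More generally, the same holds when $G_\lambda(k)$, $k\in\{0,1\}^\lambda$, is an arbitrary family of $n(\lambda)$-qubit density matrices, possibly mixed; no efficiency or security of $G$ is needed. 3. Consequently no such family is statistically pseudorandom: it is not the case that for every polynomial $t$ and every quantum algorithm $A$ of unbounded size there is a negligible function that bounds $\mathrm{Adv}_{A,t}(\lambda)$ for all $\lambda$. That is, pseudorandom states of output length at least $\log_2\lambda$ require computational assumptions on the adversary. -/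

import Mathlib

open MeasureTheory Filter

noncomputable section

namespace PRS

/-! Quantum states of registers. A register of qubits labelled by `W` has the computational basis
`W → Bool`; operators on it are matrices indexed by `W → Bool`. -/

/-- Operators on a register whose qubits are labelled by `W`. -/
abbrev Op (W : Type) : Type := Matrix (W → Bool) (W → Bool) ℂ

open scoped ComplexOrder in
/-- Density matrices of `n` qubits: positive semidefinite of trace one. -/
def DensityMatrix (n : ℕ) : Type := {ρ : Op (Fin n) // ρ.PosSemidef ∧ ρ.trace = 1}

/-- Unit vectors (pure states) of `n` qubits. -/
abbrev PureState (n : ℕ) : Type :=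
  Metric.sphere (0 : EuclideanSpace ℂ (Fin n → Bool)) 1

/-- The rank-one projector `|ψ⟩⟨ψ|`. -/
def PureState.proj {n : ℕ} (ψ : PureState n) : Op (Fin n) :=
  Matrix.of fun x y => ψ.1 x * star (ψ.1 y)

/-- The operator `|k⟩⟨k|` of a computational basis state `k`. -/
def basisState {n : ℕ} (k : Fin n → Bool) : Op (Fin n) := Matrix.single k k 1

/-- `ρ ⊗ ⋯ ⊗ ρ` (`t` copies); qubit `j` of copy `i` is labelled `(i, j)`. -/
def copies {n : ℕ} (t : ℕ) (ρ : Op (Fin n)) : Op (Fin t × Fin n) :=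
  Matrix.of fun x y => ∏ i : Fin t, ρ (fun j => x (i, j)) (fun j => y (i, j))

/-- `σ ⊗ τ` on the disjoint union of two registers. -/
def tensor {V W : Type} (σ : Op V) (τ : Op W) : Op (V ⊕ W) :=
  Matrix.of fun x y => σ (x ∘ Sum.inl) (y ∘ Sum.inl) * τ (x ∘ Sum.inr) (y ∘ Sum.inr)

/-- The Haar (uniform) probability measure on `n`-qubit pure states: the surface measure of the
unit sphere, normalized to total mass one. -/
def haarState (n : ℕ) : Measure (PureState n) :=
  ((volume : Measure (EuclideanSpace ℂ (Fin n → Bool))).toSphere Set.univ)⁻¹ •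
    (volume : Measure (EuclideanSpace ℂ (Fin n → Bool))).toSphere

/-! Generalized quantum circuits over a finite gate set. -/

/-- A finite set of unitary gates, gate `i` acting on `arity i` qubits. -/
structure GateSet where
  num : ℕ
  arity : Fin num → ℕ
  gate : (i : Fin num) → Matrix.unitaryGroup (Fin (arity i) → Bool) ℂ

/-- A gate of `S` together with the (distinct, ordered) wires among `m` that it acts on. -/
structure PlacedGate (S : GateSet) (m : ℕ) where
  idx : Fin S.num
  wires : Fin (S.arity idx) ↪ Fin m

open Classical in
/-- The gate on its wires, tensored with the identity on all other wires. -/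
def PlacedGate.op {S : GateSet} {m : ℕ} (g : PlacedGate S m) : Op (Fin m) :=
  Matrix.of fun x y =>
    if ∀ w, w ∉ Set.range g.wires → x w = y w then
      (S.gate g.idx).1 (x ∘ g.wires) (y ∘ g.wires)
    else 0

/-- The unitary of a sequence of gates, the head of the list being applied first. -/
def gatesOp {S : GateSet} {m : ℕ} : List (PlacedGate S m) → Op (Fin m)
  | [] => 1
  | g :: gs => gatesOp gs * g.op

/-- `S` is universal: for all large enough numbers `m` of qubits, every `m`-qubit unitary is
approximated arbitrarily well, up to a global phase, by sequences of gates from `S`. -/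
def GateSet.IsUniversal (S : GateSet) : Prop :=
  ∀ᶠ m : ℕ in atTop, ∀ U ∈ Matrix.unitaryGroup (Fin m → Bool) ℂ,
    U ∈ closure {M : Op (Fin m) | ∃ (gs : List (PlacedGate S m)) (z : ℂ),
      ‖z‖ = 1 ∧ M = z • gatesOp gs}

/-- A generalized quantum circuit with input qubits labelled by `I` and output qubits labelled by
`O`: it has `m` wires; the wires outside the range of `inp` are initialized to zero, and the wires
outside the range of `out` are traced out at the end. -/
structure Circuit (S : GateSet) (I O : Type) where
  m : ℕ
  inp : I ↪ Fin m
  out : O ↪ Fin m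
  gates : List (PlacedGate S m)

/-- The number of gates plus the numbers of input and output qubits (those initialized to zero and
those traced out included). -/
def Circuit.size {S : GateSet} {I O : Type} (C : Circuit S I O) : ℕ :=
  C.gates.length + C.m + C.m

open Classical in
/-- The state of all wires at the beginning: the input on the input wires, zero elsewhere. -/
def Circuit.init {S : GateSet} {I O : Type} (C : Circuit S I O) (σ : Op I) : Op (Fin C.m) :=
  Matrix.of fun x y =>
    if ∀ w, w ∉ Set.range C.inp → x w = false ∧ y w = false then σ (x ∘ C.inp) (y ∘ C.inp) else 0

open Classical in
/-- The partial trace over all wires that are not output wires. -/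
def Circuit.traceOut {S : GateSet} {I O : Type} (C : Circuit S I O) (τ : Op (Fin C.m)) : Op O :=
  Matrix.of fun a b =>
    ∑ x : Fin C.m → Bool, ∑ y : Fin C.m → Bool,
      if x ∘ C.out = a ∧ y ∘ C.out = b ∧ ∀ w, w ∉ Set.range C.out → x w = y w then τ x y else 0

/-- The quantum channel of a generalized circuit. -/
def Circuit.run {S : GateSet} {I O : Type} (C : Circuit S I O) (σ : Op I) : Op O :=
  C.traceOut (gatesOp C.gates * C.init σ * (gatesOp C.gates).conjTranspose)

/-- The probability that a circuit with one output qubit outputs `1` on input `σ`. -/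
def Circuit.accept {S : GateSet} {I : Type} (C : Circuit S I Unit) (σ : Op I) : ℝ :=
  (C.run σ (fun _ => true) (fun _ => true)).re

/-- A family of circuits is polynomial-time (QPT) if its sizes are bounded by a polynomial. -/
def IsQPT {S : GateSet} {I O : ℕ → Type} (C : (l : ℕ) → Circuit S (I l) (O l)) : Prop :=
  ∃ p : Polynomial ℕ, ∀ l, (C l).size ≤ p.eval l

/-! Pseudorandom states. -/

/-- `|Pr_k[D(ρ_k^{⊗t}) = 1] - Pr_ϑ[D(|ϑ⟩⟨ϑ|^{⊗t}) = 1]|` for a uniform key `k` of `l` bits and a Haar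
random `n`-qubit state `ϑ`, where `D σ` is the probability that the distinguisher outputs `1`. -/
def advantage {l n : ℕ} (t : ℕ) (ρ : (Fin l → Bool) → Op (Fin n))
    (D : Op (Fin t × Fin n) → ℝ) : ℝ :=
  |(∑ k : Fin l → Bool, D (copies t (ρ k))) / 2 ^ l - ∫ ϑ, D (copies t ϑ.proj) ∂(haarState n)|

/-- A negligible function. -/
def Negligible (ε : ℕ → ℝ) : Prop :=
  Asymptotics.SuperpolynomialDecay atTop (fun l : ℕ => (l : ℝ)) ε

/-- `G` is an `n(l)`-PRS generator (`l` is the security parameter): a QPT algorithm that maps every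
key to a pure state, such that polynomially many copies of its output under a random key cannot be
distinguished from copies of a Haar random state by any non-uniform QPT algorithm `A`, which may
use an advice state `adv`. -/
structure IsPRSGenerator {S : GateSet} (n : ℕ → ℕ)
    (G : (l : ℕ) → Circuit S (Fin l) (Fin (n l))) : Prop where
  qpt : IsQPT G
  stateGeneration : ∀ (l : ℕ) (k : Fin l → Bool),
    ∃ ψ : PureState (n l), (G l).run (basisState k) = ψ.proj
  pseudorandomness : ∀ (t : Polynomial ℕ) (a : ℕ → ℕ) (adv : (l : ℕ) → DensityMatrix (a l))
    (A : (l : ℕ) → Circuit S ((Fin (t.eval l) × Fin (n l)) ⊕ Fin (a l)) Unit), IsQPT A →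
    ∃ ε : ℕ → ℝ, Negligible ε ∧ ∀ l,
      advantage (t.eval l) (fun k => (G l).run (basisState k))
        (fun σ => (A l).accept (tensor σ (adv l).1)) ≤ ε l

/-- A keyed family of `n(l)`-qubit states, pure or mixed, is statistically pseudorandom over `S` if
no circuit family, of whatever size, has a non-negligible advantage on polynomially many copies. -/
def IsStatisticallyPseudorandom (S : GateSet) (n : ℕ → ℕ)
    (ρ : (l : ℕ) → (Fin l → Bool) → DensityMatrix (n l)) : Prop :=
  ∀ (t : Polynomial ℕ) (A : (l : ℕ) → Circuit S (Fin (t.eval l) × Fin (n l)) Unit),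
    ∃ ε : ℕ → ℝ, Negligible ε ∧ ∀ l,
      advantage (t.eval l) (fun k => (ρ l k).1) (A l).accept ≤ ε l

end PRS

end

/-! The distinguisher receives `t = l` copies and measures one projection `Q`. Each `ρ k` has a
dominant eigenvector; let `V` be the span of the `t`-fold powers of these, of dimension at most `2 ^
l`, let `K` be the part of the symmetric subspace orthogonal to `V`, and let `Q = 1 - P_K`.

Copies of `ρ k` are a mixture of products of eigenvectors. The power of the dominant one passes `Q`
surely; a product with two different factors lies at least half outside the symmetric subspace, so
it passes with probability at least `1/2`; powers of the other eigenvectors carry total weight at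
most `2 (1/2) ^ t`. Hence acceptance is at least `1/2 - (1/2) ^ t`
(`trace_projMatrix_mul_copies_le`).

Copies of a Haar state are symmetric, so on them `Q` acts as `P_V`. Cauchy–Schwarz in
Hilbert–Schmidt space bounds the mean acceptance by `√(dim V · m)`, where `m`, the purity of the
averaged state, is the moment `1 / choose (2 ^ n + t - 1) t` (`integral_haarState_inner_pow`). Since
`2 ^ n ≥ l`, this is at most `√(2 l / 2 ^ l)`, and the gap tends to `1/2 > 1/3`.

Finally `Q` becomes a unitary writing its outcome on a fresh wire. The advantage is continuous in
that unitary and blind to global phase, so universality yields a circuit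
(`exists_circuit_lt_advantage`). -/

noncomputable section

namespace PRS

/-! ### Moments of Haar random overlaps, from Gaussian integrals computed in two ways. -/

section GaussianMoments

variable {ι : Type*} [Fintype ι]

lemma integral_norm_pow_mul_exp_neg_complex (t : ℕ) :
    ∫ z : ℂ, ‖z‖ ^ (2 * t) * Real.exp (-‖z‖ ^ 2) = Real.pi * t.factorial := by
  have h := Complex.integral_rpow_mul_exp_neg_rpow (p := 2) (q := (2 * t : ℕ)) (by norm_num)
    (by have : (0 : ℝ) ≤ ((2 * t : ℕ) : ℝ) := Nat.cast_nonneg _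
        linarith)
  simp only [Real.rpow_natCast, Real.rpow_ofNat] at h
  rw [h]
  have : ((2 * t : ℕ) + 2 : ℝ) / 2 = t + 1 := by push_cast; ring
  rw [this, Real.Gamma_nat_eq_factorial]
  ring

lemma integral_pi_coord_moment [DecidableEq ι] (i : ι) (t : ℕ) :
    ∫ z : ι → ℂ, ‖z i‖ ^ (2 * t) * Real.exp (-∑ j, ‖z j‖ ^ 2) =
      Real.pi ^ Fintype.card ι * t.factorial := by
  have h1 : ∀ z : ι → ℂ, ‖z i‖ ^ (2 * t) * Real.exp (-∑ j, ‖z j‖ ^ 2) =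
      ∏ j, (‖z j‖ ^ (2 * (if j = i then t else 0)) * Real.exp (-‖z j‖ ^ 2)) := by
    intro z
    rw [Finset.prod_mul_distrib, ← Real.exp_sum, Finset.sum_neg_distrib]
    congr 1
    rw [Finset.prod_eq_single i]
    · simp
    · intro j _ hj; simp [hj]
    · simp
  simp_rw [h1]
  rw [integral_fintype_prod_volume_eq_prod
    (fun j (z : ℂ) => ‖z‖ ^ (2 * (if j = i then t else 0)) * Real.exp (-‖z‖ ^ 2))]
  simp_rw [integral_norm_pow_mul_exp_neg_complex]
  rw [Finset.prod_mul_distrib, Finset.prod_const, Finset.card_univ]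
  congr 1
  rw [Finset.prod_eq_single i]
  · simp
  · intro j _ hj
    simp [hj]
  · simp

/-- The Gaussian moments of a coordinate, up to the normalization of the volume. -/
lemma exists_gaussian_coord_moment [Nonempty ι] (i : ι) :
    ∃ c : ℝ, 0 < c ∧ ∀ t : ℕ,
      ∫ z : EuclideanSpace ℂ ι, ‖z i‖ ^ (2 * t) * Real.exp (-‖z‖ ^ 2) = c * t.factorial := by
  classical
  let e : EuclideanSpace ℂ ι ≃L[ℝ] (ι → ℂ) := PiLp.continuousLinearEquiv 2 ℝ (fun _ : ι => ℂ)
  let μ : Measure (ι → ℂ) := (volume : Measure (EuclideanSpace ℂ ι)).map e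
  have : μ.IsAddHaarMeasure := ContinuousLinearEquiv.isAddHaarMeasure_map e volume
  -- Uniqueness of Haar measure suffices: the scalar `a` does not depend on `t` and cancels against
  -- the zeroth moment later.
  obtain ⟨a, hpos, hμ⟩ : ∃ a : NNReal, 0 < a ∧ μ = a • volume :=
    ⟨_, Measure.addHaarScalarFactor_pos_of_isAddHaarMeasure μ volume,
      Measure.isAddLeftInvariant_eq_smul μ volume⟩
  refine ⟨(a : ℝ) * Real.pi ^ Fintype.card ι, by positivity, ?_⟩
  intro t
  have h1 : ∫ z : EuclideanSpace ℂ ι, ‖z i‖ ^ (2 * t) * Real.exp (-‖z‖ ^ 2) =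
      ∫ z, ‖z i‖ ^ (2 * t) * Real.exp (-∑ j, ‖z j‖ ^ 2) ∂μ := by
    have := (e.toHomeomorph.measurableEmbedding).integral_map (μ := volume)
      (fun z : ι → ℂ => ‖z i‖ ^ (2 * t) * Real.exp (-∑ j, ‖z j‖ ^ 2))
    refine Eq.trans ?_ this.symm
    congr 1
    ext z
    rw [EuclideanSpace.norm_sq_eq]
    rfl
  rw [h1, hμ, integral_smul_nnreal_measure, integral_pi_coord_moment, NNReal.smul_def, smul_eq_mul,
    mul_assoc]

/-- Unitary invariance of the Gaussian: extend `v` to an orthonormal basis with `v` at index `i`;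
passing to its coordinates is an isometry, hence preserves volume. -/
lemma integral_inner_moment_eq_coord [DecidableEq ι] (i : ι) (v : EuclideanSpace ℂ ι)
    (hv : ‖v‖ = 1) (t : ℕ) :
    ∫ z : EuclideanSpace ℂ ι, ‖inner ℂ v z‖ ^ (2 * t) * Real.exp (-‖z‖ ^ 2) =
      ∫ z : EuclideanSpace ℂ ι, ‖z i‖ ^ (2 * t) * Real.exp (-‖z‖ ^ 2) := by
  obtain ⟨b, hb⟩ := Orthonormal.exists_orthonormalBasis_extension_of_card_eq (𝕜 := ℂ)
    (E := EuclideanSpace ℂ ι) (ι := ι) (by simp) (v := fun _ => v) (s := {i}) (by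
      rw [orthonormal_iff_ite]
      rintro ⟨a, rfl⟩ ⟨b, rfl⟩
      simp [inner_self_eq_norm_sq_to_K, hv])
  have hbi : b i = v := hb i rfl
  let e : EuclideanSpace ℂ ι ≃ₗᵢ[ℝ] EuclideanSpace ℂ ι :=
    { (b.repr.toLinearEquiv.restrictScalars ℝ) with norm_map' := b.repr.norm_map }
  have := (e.measurePreserving).integral_comp e.toHomeomorph.measurableEmbedding
    (fun z : EuclideanSpace ℂ ι => ‖z i‖ ^ (2 * t) * Real.exp (-‖z‖ ^ 2))
  rw [← this]
  congr 1
  ext z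
  have h1 : e z i = inner ℂ v z := by
    rw [← hbi, ← b.repr_apply_apply]; rfl
  rw [h1, e.norm_map]

/-- Gaussian integrals in polar coordinates. -/
lemma integral_inner_moment_polar [Nonempty ι] (v : EuclideanSpace ℂ ι) (t : ℕ) :
    ∫ z : EuclideanSpace ℂ ι, ‖inner ℂ v z‖ ^ (2 * t) * Real.exp (-‖z‖ ^ 2) =
      (∫ θ : Metric.sphere (0 : EuclideanSpace ℂ ι) 1, ‖inner ℂ v θ.1‖ ^ (2 * t)
        ∂(volume : Measure (EuclideanSpace ℂ ι)).toSphere) *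
      (((Fintype.card ι + t - 1).factorial : ℝ) / 2) := by
  let E := EuclideanSpace ℂ ι
  have hdim : Module.finrank ℝ E = 2 * Fintype.card ι := by
    have := Module.finrank_mul_finrank ℝ ℂ E
    rw [Complex.finrank_real_complex] at this
    rw [← this]; simp [E]
  have hcard : 0 < Fintype.card ι := Fintype.card_pos
  have h0 : ∫ z : E, ‖inner ℂ v z‖ ^ (2 * t) * Real.exp (-‖z‖ ^ 2) =
      ∫ z : ({0}ᶜ : Set E), ‖inner ℂ v z.1‖ ^ (2 * t) * Real.exp (-‖z.1‖ ^ 2)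
        ∂((volume : Measure E).comap (↑)) := by
    rw [integral_subtype_comap (measurableSet_singleton _).compl
      (fun z : E => ‖inner ℂ v z‖ ^ (2 * t) * Real.exp (-‖z‖ ^ 2)), restrict_compl_singleton]
  have h1 := ((volume : Measure E).measurePreserving_homeomorphUnitSphereProd).integral_comp
    (Homeomorph.measurableEmbedding _)
    (fun p : Metric.sphere (0 : E) 1 × Set.Ioi (0 : ℝ) =>
      ‖inner ℂ v p.1.1‖ ^ (2 * t) * (p.2.1 ^ (2 * t) * Real.exp (-p.2.1 ^ 2)))
  rw [h0]
  have h2 : ∀ z : ({0}ᶜ : Set E), ‖inner ℂ v z.1‖ ^ (2 * t) * Real.exp (-‖z.1‖ ^ 2) =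
      ‖inner ℂ v (homeomorphUnitSphereProd E z).1.1‖ ^ (2 * t) *
        ((homeomorphUnitSphereProd E z).2.1 ^ (2 * t) *
          Real.exp (-(homeomorphUnitSphereProd E z).2.1 ^ 2)) := by
    intro z
    have hz : ‖z.1‖ ≠ 0 := norm_ne_zero_iff.mpr z.2
    simp only [homeomorphUnitSphereProd_apply_fst_coe, homeomorphUnitSphereProd_apply_snd_coe]
    have h3 : inner ℂ v (‖z.1‖⁻¹ • z.1) = (‖z.1‖⁻¹ : ℝ) • inner ℂ v z.1 :=
      inner_smul_right_eq_smul v z.1 (‖z.1‖⁻¹ : ℝ)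
    rw [h3, norm_smul, Real.norm_of_nonneg (inv_nonneg.mpr (norm_nonneg _)), mul_pow, inv_pow]
    field_simp
  simp_rw [h2]
  rw [h1, integral_prod_mul (fun θ : Metric.sphere (0 : E) 1 => ‖inner ℂ v θ.1‖ ^ (2 * t))
    (fun r : Set.Ioi (0 : ℝ) => r.1 ^ (2 * t) * Real.exp (-r.1 ^ 2))]
  congr 1
  rw [Measure.volumeIoiPow, integral_withDensity_eq_integral_toReal_smul]
  rotate_left
  · fun_prop
  · simp
  -- The real dimension is `2 * card ι`, so the polar density and the homogeneity factor `r ^ (2 *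
  -- t)` combine to an odd power, whose Gaussian integral is half a factorial.
  have h4 : ∀ r : Set.Ioi (0 : ℝ), (ENNReal.ofReal (r.1 ^ (Module.finrank ℝ E - 1))).toReal •
      (r.1 ^ (2 * t) * Real.exp (-r.1 ^ 2)) =
      r.1 ^ (((2 * (Fintype.card ι + t) - 1 : ℕ)) : ℝ) * Real.exp (-r.1 ^ (2 : ℝ)) := by
    intro r
    have hr : 0 < r.1 := r.2
    rw [ENNReal.toReal_ofReal (by positivity), smul_eq_mul, ← mul_assoc, ← pow_add,
      Real.rpow_natCast, hdim, Real.rpow_two]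
    congr 2
    omega
  simp_rw [h4]
  rw [integral_subtype_comap measurableSet_Ioi
    (fun r : ℝ => r ^ (((2 * (Fintype.card ι + t) - 1 : ℕ)) : ℝ) * Real.exp (-r ^ (2 : ℝ))),
    integral_rpow_mul_exp_neg_rpow two_pos (by
      have : (0 : ℝ) ≤ ((2 * (Fintype.card ι + t) - 1 : ℕ) : ℝ) := Nat.cast_nonneg _
      linarith)]
  have h5 : (((2 * (Fintype.card ι + t) - 1 : ℕ) : ℝ) + 1) / 2 =
      ((Fintype.card ι + t - 1 : ℕ) : ℝ) + 1 := by
    rw [Nat.cast_sub (by omega), Nat.cast_sub (by omega)]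
    push_cast; ring
  rw [h5, Real.Gamma_nat_eq_factorial]
  ring

end GaussianMoments

instance haarState_isProbabilityMeasure (n : ℕ) : IsProbabilityMeasure (haarState n) := by
  constructor
  rw [haarState, Measure.smul_apply, smul_eq_mul]
  refine ENNReal.inv_mul_cancel ?_ (measure_ne_top _ _)
  rw [Measure.measure_univ_ne_zero]
  exact Measure.toSphere_ne_zero _

/-- The moments of the overlap of a Haar random state with a fixed state. -/
theorem integral_haarState_inner_pow (n t : ℕ) (v : PureState n) :
    ∫ θ, ‖inner ℂ v.1 θ.1‖ ^ (2 * t) ∂(haarState n) =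
      1 / ((2 ^ n + t - 1).choose t : ℝ) := by
  classical
  obtain ⟨c, hc, h⟩ := exists_gaussian_coord_moment (fun _ : Fin n => false)
  have hv : ‖v.1‖ = 1 := by simp
  have key : ∀ s : ℕ, (∫ θ : PureState n, ‖inner ℂ v.1 θ.1‖ ^ (2 * s)
      ∂(volume : Measure (EuclideanSpace ℂ (Fin n → Bool))).toSphere) *
      (((2 ^ n + s - 1).factorial : ℝ) / 2) = c * s.factorial := by
    intro s
    rw [← h s, ← integral_inner_moment_eq_coord _ v.1 hv, integral_inner_moment_polar]
    simp
  -- The case `s = 0` gives the total mass of the sphere; dividing by it removes `c`.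
  have k0 := key 0
  have kt := key t
  have h2 : 0 < 2 ^ n := by positivity
  rw [haarState, integral_smul_measure, smul_eq_mul, ENNReal.toReal_inv]
  have hu : ∫ θ : PureState n, ‖inner ℂ v.1 θ.1‖ ^ (2 * 0)
      ∂(volume : Measure (EuclideanSpace ℂ (Fin n → Bool))).toSphere =
      ((volume : Measure (EuclideanSpace ℂ (Fin n → Bool))).toSphere Set.univ).toReal := by
    simp [Measure.real]
  rw [hu] at k0
  set A := ((volume : Measure (EuclideanSpace ℂ (Fin n → Bool))).toSphere Set.univ).toReal
  set B := ∫ θ : PureState n, ‖inner ℂ v.1 θ.1‖ ^ (2 * t)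
      ∂(volume : Measure (EuclideanSpace ℂ (Fin n → Bool))).toSphere
  rw [Nat.cast_choose ℝ (by omega : t ≤ 2 ^ n + t - 1)]
  have e1 : 2 ^ n + t - 1 - t = 2 ^ n - 1 := by omega
  rw [e1]
  simp only [add_zero, Nat.factorial_zero, Nat.cast_one, mul_one] at k0
  have p1 : (0 : ℝ) < ((2 ^ n - 1).factorial : ℝ) := by exact_mod_cast Nat.factorial_pos _
  have p2 : (0 : ℝ) < ((2 ^ n + t - 1).factorial : ℝ) := by exact_mod_cast Nat.factorial_pos _
  have p3 : (0 : ℝ) < (t.factorial : ℝ) := by exact_mod_cast Nat.factorial_pos _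
  have hA : A = 2 * c / ((2 ^ n - 1).factorial : ℝ) := by
    rw [eq_div_iff p1.ne']; linarith
  have hB : B = 2 * (c * t.factorial) / ((2 ^ n + t - 1).factorial : ℝ) := by
    rw [eq_div_iff p2.ne']; linarith
  rw [hA, hB]
  field_simp

/-! ### Second moments as Hilbert–Schmidt geometry. -/

section HilbertSchmidt

variable {κ : Type*} [Fintype κ]

/-- The operator `|v⟩⟨v|` as a vector of the Hilbert–Schmidt space. -/
def hsVec (v : EuclideanSpace ℂ κ) : EuclideanSpace ℂ (κ × κ) :=
  WithLp.toLp 2 fun p => v p.1 * star (v p.2)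

lemma inner_hsVec (v w : EuclideanSpace ℂ κ) :
    inner ℂ (hsVec v) (hsVec w) = ((‖inner ℂ v w‖ ^ 2 : ℝ) : ℂ) := by
  have h1 : ((‖inner ℂ v w‖ ^ 2 : ℝ) : ℂ) = inner ℂ v w * star (inner ℂ v w) := by
    rw [RCLike.star_def, RCLike.mul_conj]; push_cast; rfl
  rw [h1]
  simp only [PiLp.inner_apply, hsVec, RCLike.inner_apply, Fintype.sum_prod_type, star_sum,
    Finset.sum_mul_sum, star_mul', RCLike.star_def, map_mul, RCLike.conj_conj]
  refine Finset.sum_congr rfl fun a _ => Finset.sum_congr rfl fun b _ => ?_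
  ring

lemma continuous_hsVec {κ : Type*} : Continuous (hsVec : EuclideanSpace ℂ κ → _) := by
  refine (PiLp.continuous_toLp 2 _).comp ?_
  fun_prop

/-- The sum is the projection onto the span of `v`, whose squared Hilbert–Schmidt norm is its rank.
-/
lemma norm_sq_sum_hsVec_of_orthonormal {d : ℕ} {v : Fin d → EuclideanSpace ℂ κ}
    (hv : Orthonormal ℂ v) : ‖∑ i, hsVec (v i)‖ ^ 2 = d := by
  rw [← @inner_self_eq_norm_sq ℂ, sum_inner]
  simp_rw [inner_sum, inner_hsVec, orthonormal_iff_ite.mp hv]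
  simp [apply_ite]

/-- Random vectors whose overlaps have mean square `m` have a small expected component in a
subspace of dimension much less than `1 / m`. -/
lemma integral_norm_sq_starProjection_le {X : Type*} [MeasurableSpace X] {μ : Measure X}
    {w : X → EuclideanSpace ℂ κ} (hw : Integrable (fun x => hsVec (w x)) μ) {m : ℝ}
    (hm : ∀ y, ∫ x, ‖inner ℂ (w y) (w x)‖ ^ 2 ∂μ = m) [IsProbabilityMeasure μ]
    (V : Submodule ℂ (EuclideanSpace ℂ κ)) :
    ∫ x, ‖V.starProjection (w x)‖ ^ 2 ∂μ ≤ √(Module.finrank ℂ V * m) := by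
  let b := stdOrthonormalBasis ℂ V
  let v : Fin (Module.finrank ℂ V) → EuclideanSpace ℂ κ := fun i => (b i : EuclideanSpace ℂ κ)
  have hv : Orthonormal ℂ v := b.orthonormal.comp_linearIsometry V.subtypeₗᵢ
  have h1 : ∀ x, ‖V.starProjection (w x)‖ ^ 2 =
      RCLike.re (inner ℂ (∑ i, hsVec (v i)) (hsVec (w x))) := by
    intro x
    rw [sum_inner, map_sum]
    have : ‖V.starProjection (w x)‖ = ‖V.orthogonalProjectionOnto (w x)‖ := rfl
    rw [this, ← b.sum_sq_norm_inner_right]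
    refine Finset.sum_congr rfl fun i _ => ?_
    rw [inner_hsVec, Submodule.inner_orthogonalProjectionOnto_eq_of_mem_left]
    simp only [RCLike.re_eq_complex_re, Complex.ofReal_re, v]
  simp_rw [h1]
  have h2 : ∀ u, ∫ x, inner ℂ u (hsVec (w x)) ∂μ = inner ℂ u (∫ x, hsVec (w x) ∂μ) :=
    fun u => integral_inner hw u
  rw [integral_re (hw.const_inner _), h2]
  -- The purity of the averaged state is the mean squared overlap of two independent samples.
  -- Cauchy–Schwarz below then needs no formula for the average itself.
  have h3 : ‖∫ x, hsVec (w x) ∂μ‖ ^ 2 = m := by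
    rw [← @inner_self_eq_norm_sq ℂ, ← h2]
    have h4 : ∀ y, inner ℂ (∫ x, hsVec (w x) ∂μ) (hsVec (w y)) = (m : ℂ) := by
      intro y
      rw [← inner_conj_symm, ← h2]
      simp_rw [inner_hsVec]
      rw [integral_complex_ofReal, hm, Complex.conj_ofReal]
    simp [h4]
  refine (Complex.re_le_norm _).trans ((norm_inner_le_norm _ _).trans ?_)
  rw [← h3, ← norm_sq_sum_hsVec_of_orthonormal hv, ← mul_pow, Real.sqrt_sq (by positivity)]

end HilbertSchmidt

/-! ### Product vectors and the symmetric subspace. -/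

section TensorVectors

variable {t n : ℕ}

/-- The product vector `f 0 ⊗ ⋯ ⊗ f (t - 1)`. -/
def tensorVec (f : Fin t → EuclideanSpace ℂ (Fin n → Bool)) :
    EuclideanSpace ℂ (Fin t × Fin n → Bool) :=
  WithLp.toLp 2 fun x => ∏ i, f i fun j => x (i, j)

lemma sum_prod_blocks {R : Type*} [CommSemiring R] (g : Fin t → (Fin n → Bool) → R) :
    ∑ x : Fin t × Fin n → Bool, ∏ i, g i (fun j => x (i, j)) = ∏ i, ∑ y, g i y := by
  classical
  rw [Finset.prod_univ_sum, Fintype.piFinset_univ]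
  exact Fintype.sum_equiv (Equiv.curry _ _ _) _ _ fun x => rfl

lemma inner_tensorVec (f g : Fin t → EuclideanSpace ℂ (Fin n → Bool)) :
    inner ℂ (tensorVec f) (tensorVec g) = ∏ i, inner ℂ (f i) (g i) := by
  simp only [PiLp.inner_apply, tensorVec, RCLike.inner_apply, map_prod, ← Finset.prod_mul_distrib]
  exact sum_prod_blocks fun i y => g i y * (starRingEnd ℂ) (f i y)

lemma norm_tensorVec (f : Fin t → EuclideanSpace ℂ (Fin n → Bool)) (hf : ∀ i, ‖f i‖ = 1) :
    ‖tensorVec f‖ = 1 := by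
  have h := inner_self_eq_norm_sq_to_K (𝕜 := ℂ) (tensorVec f)
  rw [inner_tensorVec] at h
  simp only [inner_self_eq_norm_sq_to_K, hf] at h
  have h2 : ‖tensorVec f‖ ^ 2 = 1 := by
    have := h.symm
    simp only [algebraMap.coe_one, one_pow, Finset.prod_const_one] at this
    exact Complex.ofReal_injective (by push_cast; exact this)
  exact (pow_eq_one_iff_of_nonneg (norm_nonneg _) two_ne_zero).mp h2

/-- The vectors invariant under permutations of the `t` tensor factors. -/
def symSubspace (t n : ℕ) : Submodule ℂ (EuclideanSpace ℂ (Fin t × Fin n → Bool)) where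
  carrier := {v | ∀ (π : Equiv.Perm (Fin t)) (x : Fin t × Fin n → Bool),
    v (fun p => x (π p.1, p.2)) = v x}
  add_mem' := by
    intro a b ha hb π x
    simp [ha π x, hb π x]
  zero_mem' := by intro π x; rfl
  smul_mem' := by
    intro c a ha π x
    simp [ha π x]

lemma tensorVec_const_mem_symSubspace (v : EuclideanSpace ℂ (Fin n → Bool)) :
    tensorVec (fun _ : Fin t => v) ∈ symSubspace t n := by
  intro π x
  exact Equiv.prod_comp π fun i => v fun j => x (i, j)

lemma inner_tensorVec_perm_of_mem_symSubspace {v : EuclideanSpace ℂ (Fin t × Fin n → Bool)}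
    (hv : v ∈ symSubspace t n) (f : Fin t → EuclideanSpace ℂ (Fin n → Bool))
    (π : Equiv.Perm (Fin t)) :
    inner ℂ v (tensorVec (f ∘ π)) = inner ℂ v (tensorVec f) := by
  simp only [PiLp.inner_apply, tensorVec, RCLike.inner_apply]
  refine Fintype.sum_equiv (Equiv.arrowCongr (Equiv.prodCongr π (Equiv.refl _)) (Equiv.refl _))
    _ _ fun x => ?_
  have h := hv π.symm x
  congr 1
  · refine Fintype.prod_equiv π _ _ fun i => ?_
    simp
  · exact congrArg _ h.symm

/-- Swapping two orthogonal factors gives an orthogonal unit vector with the same projection onto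
`K`. The sum of the two has norm `√2` and projects to twice that projection. -/
lemma norm_starProjection_le_of_swap {K : Submodule ℂ (EuclideanSpace ℂ (Fin t × Fin n → Bool))}
    (hK : K ≤ symSubspace t n) (f : Fin t → EuclideanSpace ℂ (Fin n → Bool))
    (hf : ∀ i, ‖f i‖ = 1) {i j : Fin t} (hij : inner ℂ (f i) (f j) = 0) :
    ‖K.starProjection (tensorVec f)‖ ^ 2 ≤ 1 / 2 := by
  set u := tensorVec f
  set u' := tensorVec (f ∘ Equiv.swap i j)
  have h1 : K.starProjection u' = K.starProjection u := by
    rw [← sub_eq_zero, ← map_sub, Submodule.starProjection_apply_eq_zero_iff]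
    intro v hv
    rw [inner_sub_right, inner_tensorVec_perm_of_mem_symSubspace (hK hv), sub_self]
  have hu : ‖u‖ = 1 := norm_tensorVec f hf
  have hu' : ‖u'‖ = 1 := norm_tensorVec _ fun _ => hf _
  have h2 : inner ℂ u u' = 0 := by
    rw [inner_tensorVec]
    refine Finset.prod_eq_zero (Finset.mem_univ i) ?_
    simpa using hij
  have h3 : ‖u + u'‖ * ‖u + u'‖ = ‖u‖ * ‖u‖ + ‖u'‖ * ‖u'‖ :=
    norm_add_sq_eq_norm_sq_add_norm_sq_of_inner_eq_zero u u' h2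
  have h4 : ‖K.starProjection (u + u')‖ ≤ ‖u + u'‖ := K.norm_starProjection_apply_le _
  rw [map_add, h1, ← two_smul ℂ, norm_smul] at h4
  norm_num at h4
  rw [hu, hu'] at h3
  nlinarith [norm_nonneg (K.starProjection u), norm_nonneg (u + u')]

end TensorVectors

/-! ### Projections as measurement operators. -/

section Expectation

variable {κ : Type*} [Fintype κ] [DecidableEq κ]

/-- The matrix of the orthogonal projection onto `K`. -/
def projMatrix (K : Submodule ℂ (EuclideanSpace ℂ κ)) : Matrix κ κ ℂ :=
  (Matrix.toEuclideanCLM (n := κ) (𝕜 := ℂ)).symm K.starProjection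

lemma conjTranspose_projMatrix (K : Submodule ℂ (EuclideanSpace ℂ κ)) :
    (projMatrix K).conjTranspose = projMatrix K := by
  have h : star K.starProjection = K.starProjection :=
    isStarProjection_starProjection.isSelfAdjoint
  conv_rhs => rw [projMatrix, ← h]
  exact ((Matrix.toEuclideanCLM (n := κ) (𝕜 := ℂ)).symm.map_star' _).symm

lemma projMatrix_mul_self (K : Submodule ℂ (EuclideanSpace ℂ κ)) :
    projMatrix K * projMatrix K = projMatrix K := by
  rw [projMatrix, ← map_mul]
  congr 1
  exact isStarProjection_starProjection.isIdempotentElem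

lemma trace_projMatrix_mul (K : Submodule ℂ (EuclideanSpace ℂ κ)) (v : EuclideanSpace ℂ κ) :
    (projMatrix K * Matrix.vecMulVec v (star v.ofLp)).trace =
      ((‖K.starProjection v‖ ^ 2 : ℝ) : ℂ) := by
  rw [Matrix.mul_vecMulVec, Matrix.trace_vecMulVec]
  have h1 : Matrix.toEuclideanCLM (n := κ) (𝕜 := ℂ) (projMatrix K) = K.starProjection :=
    StarAlgEquiv.apply_symm_apply _ _
  have h2 : (projMatrix K).mulVec v.ofLp = (K.starProjection v).ofLp := by
    rw [← h1]; rfl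
  rw [h2, ← EuclideanSpace.inner_eq_star_dotProduct]
  have h3 : inner ℂ v (K.starProjection v) =
      inner ℂ (K.starProjection v) (K.starProjection v) := by
    rw [Submodule.inner_starProjection_left_eq_right,
      Submodule.starProjection_eq_self_iff.mpr (K.starProjection_apply_mem v)]
  rw [h3, inner_self_eq_norm_sq_to_K]
  push_cast; rfl

end Expectation

/-! ### Copies of mixed states. -/

section MixedStates

variable {t n : ℕ}

open scoped ComplexOrder in
lemma DensityMatrix.exists_eigenbasis (ρ : DensityMatrix n) :
    ∃ (p : (Fin n → Bool) → ℝ)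
      (b : OrthonormalBasis (Fin n → Bool) ℂ (EuclideanSpace ℂ (Fin n → Bool))),
      (∀ j, 0 ≤ p j) ∧ ∑ j, p j = 1 ∧
      ∀ x y, ρ.1 x y = ∑ j, (p j : ℂ) * (b j x * star (b j y)) := by
  obtain ⟨ρ, hρ, htr⟩ := ρ
  refine ⟨hρ.1.eigenvalues, hρ.1.eigenvectorBasis, hρ.eigenvalues_nonneg, ?_, ?_⟩
  · rw [hρ.1.trace_eq_sum_eigenvalues] at htr
    exact Complex.ofReal_injective (by push_cast; exact htr)
  · intro x y
    refine (congrFun (congrFun hρ.1.spectral_theorem x) y).trans ?_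
    rw [Unitary.conjStarAlgAut_apply, Matrix.mul_assoc, Matrix.mul_apply]
    refine Finset.sum_congr rfl fun j _ => ?_
    rw [Matrix.diagonal_mul, Matrix.star_apply, Matrix.IsHermitian.eigenvectorUnitary_apply,
      Matrix.IsHermitian.eigenvectorUnitary_apply]
    simp only [Function.comp_apply, Complex.coe_algebraMap]
    ring

lemma copies_eq_sum {ρ : Op (Fin n)} {p : (Fin n → Bool) → ℝ}
    {b : (Fin n → Bool) → EuclideanSpace ℂ (Fin n → Bool)}
    (h : ∀ x y, ρ x y = ∑ j, (p j : ℂ) * (b j x * star (b j y))) :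
    copies t ρ = ∑ J : Fin t → Fin n → Bool, ((∏ i, p (J i) : ℝ) : ℂ) •
      Matrix.vecMulVec (tensorVec (b ∘ J)).ofLp (star (tensorVec (b ∘ J)).ofLp) := by
  classical
  ext x y
  simp only [copies, Matrix.of_apply, h, Matrix.sum_apply, Matrix.smul_apply,
    Matrix.vecMulVec_apply, smul_eq_mul]
  rw [Finset.prod_univ_sum, Fintype.piFinset_univ]
  refine Finset.sum_congr rfl fun J _ => ?_
  rw [Finset.prod_mul_distrib, Finset.prod_mul_distrib]
  simp [tensorVec]

lemma copies_proj (ψ : PureState n) :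
    copies t ψ.proj = Matrix.vecMulVec (tensorVec fun _ : Fin t => ψ.1).ofLp
      (star (tensorVec fun _ : Fin t => ψ.1).ofLp) := by
  ext x y
  simp [copies, PureState.proj, tensorVec, Matrix.vecMulVec_apply, Finset.prod_mul_distrib]

lemma trace_copies (t : ℕ) (ρ : Op (Fin n)) (hρ : ρ.trace = 1) : (copies t ρ).trace = 1 := by
  simp only [Matrix.trace, Matrix.diag, copies, Matrix.of_apply] at hρ ⊢
  rw [sum_prod_blocks fun _ y => ρ y y, hρ, Finset.prod_const_one]

/-- Copies of a mixed state pass the projection onto a subspace of the symmetric subspace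
orthogonal to the copies of a dominant eigenvector with probability hardly more than `1 / 2`. -/
lemma trace_projMatrix_mul_copies_le (ht : 0 < t) {ρ : Op (Fin n)} {p : (Fin n → Bool) → ℝ}
    {b : (Fin n → Bool) → EuclideanSpace ℂ (Fin n → Bool)} (hb : Orthonormal ℂ b)
    (hp : ∀ j, 0 ≤ p j) (hsum : ∑ j, p j = 1)
    (h : ∀ x y, ρ x y = ∑ j, (p j : ℂ) * (b j x * star (b j y)))
    {c : Fin n → Bool} (hc : ∀ j, p j ≤ p c)
    {K : Submodule ℂ (EuclideanSpace ℂ (Fin t × Fin n → Bool))} (hK : K ≤ symSubspace t n)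
    (hKc : tensorVec (fun _ : Fin t => b c) ∈ Kᗮ) :
    (projMatrix K * copies t ρ).trace.re ≤ 1 / 2 + (1 / 2) ^ t := by
  classical
  have e1 : (projMatrix K * copies t ρ).trace.re =
      ∑ J : Fin t → Fin n → Bool, (∏ i, p (J i)) * ‖K.starProjection (tensorVec (b ∘ J))‖ ^ 2 := by
    rw [copies_eq_sum h, Finset.mul_sum, Matrix.trace_sum, Complex.re_sum]
    refine Finset.sum_congr rfl fun J _ => ?_
    rw [Matrix.mul_smul, Matrix.trace_smul, trace_projMatrix_mul, smul_eq_mul,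
      ← Complex.ofReal_mul, Complex.ofReal_re]
  -- Three cases: `J` constantly `c` contributes zero by `hKc`, any other constant at most one, and
  -- a non-constant `J` at most `1/2` by swapping.
  have e2 : ∀ J : Fin t → Fin n → Bool, ‖K.starProjection (tensorVec (b ∘ J))‖ ^ 2 ≤
      1 / 2 + 1 / 2 * ∑ j ∈ Finset.univ.erase c, if J = fun _ => j then 1 else 0 := by
    intro J
    have h2 : (0 : ℝ) ≤ ∑ j ∈ Finset.univ.erase c, if J = fun _ => j then 1 else 0 :=
      Finset.sum_nonneg fun _ _ => by positivity
    by_cases hJ : ∀ i j, J i = J j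
    · obtain ⟨a, rfl⟩ : ∃ a, J = fun _ => a := ⟨J ⟨0, ht⟩, funext fun i => hJ _ _⟩
      by_cases hac : a = c
      · subst hac
        have : K.starProjection (tensorVec (b ∘ fun _ : Fin t => a)) = 0 :=
          K.starProjection_apply_eq_zero_iff.mpr hKc
        rw [this, norm_zero]
        linarith
      · have h1 : ‖K.starProjection (tensorVec (b ∘ fun _ : Fin t => a))‖ ≤ 1 := by
          refine (K.norm_starProjection_apply_le _).trans (norm_tensorVec _ fun i => ?_).le
          exact hb.1 _
        have h2 : ∑ j ∈ Finset.univ.erase c,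
            (if (fun _ : Fin t => a) = fun _ => j then (1 : ℝ) else 0) = 1 := by
          rw [Finset.sum_eq_single a]
          · simp
          · intro j _ hj
            refine if_neg fun hh => hj ?_
            exact (congrFun hh ⟨0, ht⟩).symm
          · simp [hac]
        rw [h2]
        nlinarith [norm_nonneg (K.starProjection (tensorVec (b ∘ fun _ : Fin t => a)))]
    · push Not at hJ
      obtain ⟨i, j, hij⟩ := hJ
      have h1 := norm_starProjection_le_of_swap hK (b ∘ J) (fun i => hb.1 _) (i := i) (j := j)
        (hb.2 hij)
      linarith
  have e3 : ∑ J : Fin t → Fin n → Bool, ∏ i, p (J i) = 1 := by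
    have := Finset.prod_univ_sum (fun _ : Fin t => (Finset.univ : Finset (Fin n → Bool)))
      (fun _ j => p j)
    rw [Fintype.piFinset_univ] at this
    rw [← this, hsum, Finset.prod_const_one]
  have e4 : ∑ J : Fin t → Fin n → Bool, (∏ i, p (J i)) *
      (∑ j ∈ Finset.univ.erase c, if J = fun _ => j then 1 else 0) =
      ∑ j ∈ Finset.univ.erase c, p j ^ t := by
    simp_rw [Finset.mul_sum]
    rw [Finset.sum_comm]
    refine Finset.sum_congr rfl fun j _ => ?_
    simp
  have e5 : ∑ j ∈ Finset.univ.erase c, p j ^ t ≤ (1 / 2) ^ (t - 1) := by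
    have h1 : ∀ j ∈ Finset.univ.erase c, p j ^ t ≤ p j * (1 / 2) ^ (t - 1) := by
      intro j hj
      have hjc : j ≠ c := Finset.ne_of_mem_erase hj
      have h2 : p j + p c ≤ 1 := by
        rw [← hsum, ← Finset.sum_pair hjc]
        exact Finset.sum_le_sum_of_subset_of_nonneg (Finset.subset_univ _) fun i _ _ => hp i
      -- Only the largest eigenvalue can exceed `1/2`.
      have h3 : p j ≤ 1 / 2 := by linarith [hc j]
      obtain ⟨s, rfl⟩ : ∃ s, t = s + 1 := ⟨t - 1, by omega⟩
      rw [pow_succ', Nat.add_sub_cancel]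
      exact mul_le_mul_of_nonneg_left (pow_le_pow_left₀ (hp j) h3 s) (hp j)
    refine (Finset.sum_le_sum h1).trans ?_
    rw [← Finset.sum_mul]
    have h4 : ∑ j ∈ Finset.univ.erase c, p j ≤ 1 := by
      rw [← hsum]
      exact Finset.sum_le_sum_of_subset_of_nonneg (Finset.subset_univ _) fun i _ _ => hp i
    have h5 : (0 : ℝ) ≤ (1 / 2) ^ (t - 1) := by positivity
    nlinarith
  rw [e1]
  calc _ ≤ ∑ J : Fin t → Fin n → Bool, (∏ i, p (J i)) * (1 / 2 + 1 / 2 *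
        ∑ j ∈ Finset.univ.erase c, if J = fun _ => j then 1 else 0) :=
        Finset.sum_le_sum fun J _ => mul_le_mul_of_nonneg_left (e2 J)
          (Finset.prod_nonneg fun i _ => hp _)
    _ = 1 / 2 * ∑ J : Fin t → Fin n → Bool, ∏ i, p (J i) +
        1 / 2 * ∑ J : Fin t → Fin n → Bool, (∏ i, p (J i)) *
          (∑ j ∈ Finset.univ.erase c, if J = fun _ => j then 1 else 0) := by
        rw [Finset.mul_sum, Finset.mul_sum, ← Finset.sum_add_distrib]
        exact Finset.sum_congr rfl fun J _ => by ring
    _ ≤ 1 / 2 * 1 + 1 / 2 * (1 / 2) ^ (t - 1) := by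
        rw [e3, e4]; linarith
    _ = 1 / 2 + (1 / 2) ^ t := by
        obtain ⟨s, rfl⟩ : ∃ s, t = s + 1 := ⟨t - 1, by omega⟩
        rw [Nat.add_sub_cancel, pow_succ]; ring

end MixedStates

/-! ### The ideal distinguishing measurement. -/

lemma continuous_tensorVec_const (t n : ℕ) :
    Continuous fun v : EuclideanSpace ℂ (Fin n → Bool) => tensorVec fun _ : Fin t => v := by
  refine (PiLp.continuous_toLp 2 _).comp ?_
  fun_prop

/-- Haar random states have small expected weight in the span of few product vectors. -/
lemma integral_haarState_starProjection_le (t n : ℕ)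
    (V : Submodule ℂ (EuclideanSpace ℂ (Fin t × Fin n → Bool))) :
    ∫ θ : PureState n, ‖V.starProjection (tensorVec fun _ : Fin t => θ.1)‖ ^ 2 ∂(haarState n) ≤
      √(Module.finrank ℂ V * (1 / ((2 ^ n + t - 1).choose t : ℝ))) := by
  refine integral_norm_sq_starProjection_le ?_ (fun y => ?_) V
  · refine Continuous.integrable_of_hasCompactSupport ?_ (HasCompactSupport.of_compactSpace _)
    exact continuous_hsVec.comp ((continuous_tensorVec_const t n).comp continuous_subtype_val)
  · rw [← integral_haarState_inner_pow n t y]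
    refine integral_congr_ae (Eventually.of_forall fun x => ?_)
    simp only [inner_tensorVec, Finset.prod_const, Finset.card_univ, Fintype.card_fin, norm_pow]
    rw [← pow_mul, mul_comm]

open scoped ComplexOrder in
/-- A projective measurement that tells copies of a random member of a keyed family of states from
copies of a Haar random state. -/
theorem exists_distinguishing_projection {l n t : ℕ} (ht : 0 < t)
    (ρ : (Fin l → Bool) → DensityMatrix n) :
    ∃ Q : Op (Fin t × Fin n), Q.conjTranspose = Q ∧ Q * Q = Q ∧
      (∀ k, 1 / 2 - (1 / 2) ^ t ≤ (Q * copies t (ρ k).1).trace.re) ∧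
      ∫ θ : PureState n, (Q * copies t θ.proj).trace.re ∂(haarState n) ≤
        √(2 ^ l * (1 / ((2 ^ n + t - 1).choose t : ℝ))) := by
  classical
  choose p b hp hsum hρ using fun k => (ρ k).exists_eigenbasis
  choose c hc using fun k => Finite.exists_max (p k)
  let φ : (Fin l → Bool) → EuclideanSpace ℂ (Fin t × Fin n → Bool) :=
    fun k => tensorVec fun _ => b k (c k)
  let V := Submodule.span ℂ (Set.range φ)
  -- Projecting onto `V` alone would fail for mixed states, whose copies may have tiny weight there.
  -- Accepting everything orthogonal to the symmetric subspace as well costs nothing on Haar copies.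
  let K := symSubspace t n ⊓ Vᗮ
  have hVs : V ≤ symSubspace t n := by
    rw [Submodule.span_le]
    rintro _ ⟨k, rfl⟩
    exact tensorVec_const_mem_symSubspace _
  have hVK : V ≤ Kᗮ := (Submodule.le_orthogonal_orthogonal V).trans
    (Submodule.orthogonal_le inf_le_right)
  refine ⟨1 - projMatrix K, ?_, ?_, fun k => ?_, ?_⟩
  · rw [Matrix.conjTranspose_sub, Matrix.conjTranspose_one, conjTranspose_projMatrix]
  · rw [sub_mul, mul_sub, mul_sub, projMatrix_mul_self]
    simp
  · rw [sub_mul, one_mul, Matrix.trace_sub, trace_copies t _ (ρ k).2.2, Complex.sub_re,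
      Complex.one_re]
    have := trace_projMatrix_mul_copies_le ht (b k).orthonormal (hp k) (hsum k) (hρ k) (hc k)
      (K := K) inf_le_left (hVK (Submodule.subset_span ⟨k, rfl⟩))
    linarith
  -- Both `w` and its projection onto `V` are symmetric, so their difference lies in `K` and equals
  -- the projection of `w` onto `K`.
  · have h1 : ∀ θ : PureState n, ((1 - projMatrix K) * copies t θ.proj).trace.re =
        ‖V.starProjection (tensorVec fun _ : Fin t => θ.1)‖ ^ 2 := by
      intro θ
      set w := tensorVec fun _ : Fin t => θ.1 with hw
      have hθ : ‖θ.1‖ = 1 := by simp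
      have hw1 : ‖w‖ = 1 := norm_tensorVec _ fun _ => hθ
      have hpr : copies t θ.proj = Matrix.vecMulVec w.ofLp (star w.ofLp) := copies_proj θ
      have htr : (Matrix.vecMulVec w.ofLp (star w.ofLp)).trace = 1 := by
        rw [Matrix.trace_vecMulVec, ← EuclideanSpace.inner_eq_star_dotProduct,
          inner_self_eq_norm_sq_to_K, hw1]
        simp
      rw [sub_mul, one_mul, Matrix.trace_sub, hpr, htr, trace_projMatrix_mul, Complex.sub_re,
        Complex.one_re, Complex.ofReal_re]
      have hk : w - V.starProjection w ∈ K :=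
        ⟨Submodule.sub_mem _ (tensorVec_const_mem_symSubspace _)
          (hVs (V.starProjection_apply_mem w)), Submodule.sub_starProjection_mem_orthogonal w⟩
      have hPK : K.starProjection w = w - V.starProjection w := by
        have h2 : K.starProjection (V.starProjection w) = 0 :=
          K.starProjection_apply_eq_zero_iff.mpr (hVK (V.starProjection_apply_mem w))
        have h3 := Submodule.starProjection_eq_self_iff.mpr hk
        rwa [map_sub, h2, sub_zero] at h3
      have h4 : ‖w‖ * ‖w‖ = ‖V.starProjection w‖ * ‖V.starProjection w‖ +
          ‖w - V.starProjection w‖ * ‖w - V.starProjection w‖ := by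
        conv_lhs => rw [← add_sub_cancel (V.starProjection w) w]
        refine norm_add_sq_eq_norm_sq_add_norm_sq_of_inner_eq_zero (𝕜 := ℂ) _ _ ?_
        exact (Submodule.sub_starProjection_mem_orthogonal w) _ (V.starProjection_apply_mem w)
      rw [hPK]
      rw [hw1] at h4
      linarith
    simp_rw [h1]
    refine (integral_haarState_starProjection_le t n V).trans (Real.sqrt_le_sqrt ?_)
    refine mul_le_mul_of_nonneg_right ?_ (by positivity)
    have : Module.finrank ℂ V ≤ Fintype.card (Fin l → Bool) := finrank_range_le_card φ
    simp only [Fintype.card_fun, Fintype.card_bool, Fintype.card_fin] at this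
    exact_mod_cast this

/-! ### Acceptance as a function of the operator on the wires. -/

section Acceptance

variable {S : GateSet} {I : Type}

/-- The unnormalized acceptance amplitude `σ ↦ ⟨1| tr (W (σ ⊗ |0⟩⟨0|) W†) |1⟩` of the wiring of `C`,
for an arbitrary operator `W` in place of the gates. -/
def Circuit.acceptMap (C : Circuit S I Unit) (W : Op (Fin C.m)) : Op I →ₗ[ℂ] ℂ where
  toFun σ := C.traceOut (W * C.init σ * W.conjTranspose) (fun _ => true) (fun _ => true)
  map_add' σ τ := by
    have h : C.init (σ + τ) = C.init σ + C.init τ := by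
      ext x y
      simp only [Circuit.init, Matrix.of_apply, Matrix.add_apply]
      split_ifs <;> simp
    rw [h, mul_add, add_mul]
    simp only [Circuit.traceOut, Matrix.of_apply, Matrix.add_apply, ← Finset.sum_add_distrib]
    refine Finset.sum_congr rfl fun x _ => Finset.sum_congr rfl fun y _ => ?_
    split_ifs <;> simp
  map_smul' c σ := by
    have h : C.init (c • σ) = c • C.init σ := by
      ext x y
      simp only [Circuit.init, Matrix.of_apply, Matrix.smul_apply]
      split_ifs <;> simp
    rw [h, mul_smul_comm, smul_mul_assoc]
    simp only [Circuit.traceOut, Matrix.of_apply, Matrix.smul_apply, RingHom.id_apply,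
      Finset.smul_sum]
    refine Finset.sum_congr rfl fun x _ => Finset.sum_congr rfl fun y _ => ?_
    split_ifs <;> simp

lemma Circuit.continuous_acceptMap (C : Circuit S I Unit) (σ : Op I) :
    Continuous fun W => C.acceptMap W σ := by
  have h : Continuous fun W : Op (Fin C.m) => W * C.init σ * W.conjTranspose := by fun_prop
  refine continuous_finsetSum _ fun x _ => continuous_finsetSum _ fun y _ => ?_
  split_ifs
  · exact h.matrix_elem x y
  · exact continuous_const

/-- Conjugation by `W` cancels a phase, so approximation up to a global phase is enough. -/
lemma Circuit.acceptMap_smul (C : Circuit S I Unit) {z : ℂ} (hz : ‖z‖ = 1) (W : Op (Fin C.m)) :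
    C.acceptMap (z • W) = C.acceptMap W := by
  ext σ
  have h : z • W * C.init σ * (z • W).conjTranspose = W * C.init σ * W.conjTranspose := by
    rw [Matrix.conjTranspose_smul, Matrix.mul_smul, smul_mul_assoc, smul_mul_assoc, smul_smul,
      RCLike.star_def, RCLike.conj_mul, hz]
    simp
  change C.traceOut _ _ _ = C.traceOut _ _ _
  rw [h]

lemma Circuit.traceOut_unit (C : Circuit S I Unit) (τ : Op (Fin C.m)) :
    C.traceOut τ (fun _ => true) (fun _ => true) =
      ∑ x, if x (C.out ()) = true then τ x x else 0 := by
  classical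
  simp only [Circuit.traceOut, Matrix.of_apply]
  refine Finset.sum_congr rfl fun x _ => ?_
  rw [Finset.sum_eq_single x]
  · by_cases h : x (C.out ()) = true
    · rw [if_pos h, if_pos ⟨funext fun _ => h, funext fun _ => h, fun _ _ => rfl⟩]
    · rw [if_neg h, if_neg fun h' => h (congrFun h'.1 ())]
  · intro y _ hyx
    refine if_neg fun h => hyx (funext fun w => ?_)
    by_cases hw : w ∈ Set.range C.out
    · obtain ⟨u, rfl⟩ := hw
      exact (congrFun h.2.1 u).trans (congrFun h.1 u).symm
    · exact (h.2.2 w hw).symm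
  · simp

end Acceptance

/-! ### Splitting the wires into inputs and ancillas. -/

section Wires

variable {I : Type} {m : ℕ}

/-- Basis states of all wires as pairs of basis states of the input wires and the other wires. -/
def splitWires (inp : I ↪ Fin m) :
    (Fin m → Bool) ≃ (I → Bool) × ({w : Fin m // w ∉ Set.range inp} → Bool) := by
  classical
  exact (Equiv.piEquivPiSubtypeProd (fun w => w ∈ Set.range inp) fun _ => Bool).trans
    (Equiv.prodCongr (Equiv.arrowCongr (Equiv.ofInjective inp inp.injective).symm (Equiv.refl _))
      (Equiv.refl _))

lemma splitWires_fst (inp : I ↪ Fin m) (x : Fin m → Bool) : (splitWires inp x).1 = x ∘ inp := by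
  rfl

lemma splitWires_snd (inp : I ↪ Fin m) (x : Fin m → Bool) (w : {w // w ∉ Set.range inp}) :
    (splitWires inp x).2 w = x w := by
  rfl

end Wires

/-! ### Implementing a projective measurement by a unitary. -/

section Measurement

open scoped Kronecker

variable {I : Type} [Fintype I]

/-- Flipping the bit `o`. -/
def flipBit {R : Type*} [DecidableEq R] (o : R) : Equiv.Perm (R → Bool) :=
  Function.Involutive.toPerm (fun b => Function.update b o (!b o)) fun b => by
    ext w
    by_cases h : w = o
    · subst h; simp
    · simp [h]

/-- The unitary that flips the bit `o` if the projective measurement `Q` succeeds. -/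
def measureOp {R : Type*} [Fintype R] [DecidableEq R] (Q : Op I) (o : R) :
    Matrix ((I → Bool) × (R → Bool)) ((I → Bool) × (R → Bool)) ℂ :=
  Q ⊗ₖ (flipBit o).permMatrix ℂ + (1 - Q) ⊗ₖ 1

lemma measureOp_conjTranspose {R : Type*} [Fintype R] [DecidableEq R] {Q : Op I} (o : R)
    (hQ : Q.conjTranspose = Q) :
    (measureOp Q o).conjTranspose = measureOp Q o := by
  have h : (flipBit o).symm = flipBit o := rfl
  rw [measureOp, Matrix.conjTranspose_add, Matrix.conjTranspose_kronecker,
    Matrix.conjTranspose_kronecker, Matrix.conjTranspose_permMatrix]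
  simp only [Matrix.conjTranspose_sub, Matrix.conjTranspose_one, hQ]
  rw [Equiv.Perm.inv_def, h]

lemma permMatrix_flipBit_mul_self {R : Type*} [Fintype R] [DecidableEq R] (o : R) :
    (flipBit o).permMatrix ℂ * (flipBit o).permMatrix ℂ = 1 := by
  rw [← Matrix.permMatrix_mul]
  have : flipBit o * flipBit o = 1 := by
    ext1 b
    exact (flipBit o).symm_apply_apply b
  rw [this, Matrix.permMatrix_one]

lemma measureOp_mul_self [DecidableEq I] {R : Type*} [Fintype R] [DecidableEq R] {Q : Op I} (o : R)
    (hQ : Q * Q = Q) : measureOp Q o * measureOp Q o = 1 := by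
  have h1 : Q * (1 - Q) = 0 := by rw [mul_sub, mul_one, hQ, sub_self]
  have h2 : (1 - Q) * Q = 0 := by rw [sub_mul, one_mul, hQ, sub_self]
  have h3 : (1 - Q) * (1 - Q) = 1 - Q := by rw [mul_sub, mul_one, h2, sub_zero]
  rw [measureOp, add_mul, mul_add, mul_add]
  simp only [← Matrix.mul_kronecker_mul, h1, h2, h3, hQ, permMatrix_flipBit_mul_self, one_mul,
    Matrix.zero_kronecker, add_zero, zero_add]
  rw [← Matrix.add_kronecker, add_sub_cancel, Matrix.one_kronecker_one]

/-- The probability that the flipped bit reads `1` is the success probability of `Q`. -/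
lemma trace_measureOp [DecidableEq I] {R : Type*} [Fintype R] [DecidableEq R] {Q : Op I} (o : R)
    (hQ : Q * Q = Q) (σ : Op I) :
    ((1 ⊗ₖ Matrix.diagonal fun b : R → Bool => if b o = true then (1 : ℂ) else 0) *
      (measureOp Q o * (σ ⊗ₖ Matrix.single (fun _ => false) (fun _ => false) 1) *
        measureOp Q o)).trace = (Q * σ).trace := by
  set D : Matrix (R → Bool) (R → Bool) ℂ :=
    Matrix.diagonal fun b : R → Bool => if b o = true then (1 : ℂ) else 0 with hD
  set P : Matrix (R → Bool) (R → Bool) ℂ := Matrix.single (fun _ => false) (fun _ => false) 1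
  -- The bit `o` starts at zero, so of the four terms of the conjugation only the one flipped on
  -- both sides survives the test that it reads `1`.
  have hDP : D * P = 0 := by
    ext a b
    rw [hD, Matrix.diagonal_mul]
    by_cases h : (fun _ : R => false) = a
    · subst h; simp
    · simp [P, h]
  have hPD : P * D = 0 := by
    ext a b
    rw [hD, Matrix.mul_diagonal]
    by_cases h : (fun _ : R => false) = b
    · subst h; simp
    · simp [P, h]
  set X := (flipBit o).permMatrix ℂ
  have hXPX : (D * (X * P * X)).trace = 1 := by
    have h1 : X * P * X = P.submatrix (flipBit o) (flipBit o) := by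
      rw [PEquiv.toMatrix_toPEquiv_mul, PEquiv.mul_toMatrix_toPEquiv, Matrix.submatrix_submatrix]
      rfl
    rw [h1, Matrix.trace, Fintype.sum_eq_single (flipBit o fun _ => false)]
    · rw [Matrix.diag_apply, hD, Matrix.diagonal_mul, Matrix.submatrix_apply]
      have h2 : flipBit o (flipBit o fun _ => false) = fun _ => false :=
        (flipBit o).symm_apply_apply _
      rw [h2]
      have h3 : flipBit o (fun _ => false) o = true := by
        change Function.update (fun _ => false) o (!false) o = true
        simp
      simp [P, h3]
    · intro b hb
      rw [Matrix.diag_apply, hD, Matrix.diagonal_mul, Matrix.submatrix_apply]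
      have h2 : (fun _ => false) ≠ flipBit o b := by
        intro h
        refine hb ?_
        rw [h]
        exact ((flipBit o).symm_apply_apply b).symm
      simp [P, h2]
  have hXP : (D * (X * P)).trace = 0 := by
    rw [Matrix.trace_mul_comm, Matrix.mul_assoc, hPD, Matrix.mul_zero, Matrix.trace_zero]
  have hPX : (D * (P * X)).trace = 0 := by
    rw [← Matrix.mul_assoc, hDP, Matrix.zero_mul, Matrix.trace_zero]
  simp only [measureOp, add_mul, mul_add, ← Matrix.mul_kronecker_mul, Matrix.trace_add,
    Matrix.trace_kronecker]
  simp only [one_mul, mul_one]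
  rw [hXPX, hXP, hPX, hDP, Matrix.trace_zero]
  simp only [mul_zero, add_zero, mul_one]
  rw [Matrix.mul_assoc, Matrix.trace_mul_comm, Matrix.mul_assoc, hQ, Matrix.trace_mul_comm]

variable {S : GateSet}

/-- The unitary on all wires of `C` that writes the outcome of the measurement `Q` of the input
into the output wire. -/
def Circuit.measureUnitary (C : Circuit S I Unit) (h : C.out () ∉ Set.range C.inp) (Q : Op I) :
    Op (Fin C.m) :=
  (measureOp Q (⟨C.out (), h⟩ : {w // w ∉ Set.range C.inp})).submatrix
    (splitWires C.inp) (splitWires C.inp)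

lemma Circuit.conjTranspose_measureUnitary (C : Circuit S I Unit)
    (h : C.out () ∉ Set.range C.inp) {Q : Op I} (hQ : Q.conjTranspose = Q) :
    (C.measureUnitary h Q).conjTranspose = C.measureUnitary h Q := by
  rw [Circuit.measureUnitary, Matrix.conjTranspose_submatrix, measureOp_conjTranspose _ hQ]

lemma Circuit.measureUnitary_mem_unitaryGroup [DecidableEq I] (C : Circuit S I Unit)
    (h : C.out () ∉ Set.range C.inp) {Q : Op I} (hQ : Q.conjTranspose = Q) (hQ2 : Q * Q = Q) :
    C.measureUnitary h Q ∈ Matrix.unitaryGroup (Fin C.m → Bool) ℂ := by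
  rw [Matrix.mem_unitaryGroup_iff, Matrix.star_eq_conjTranspose,
    C.conjTranspose_measureUnitary h hQ, Circuit.measureUnitary, Matrix.submatrix_mul_equiv,
    measureOp_mul_self _ hQ2, Matrix.submatrix_one_equiv]

lemma Circuit.init_eq_submatrix (C : Circuit S I Unit) (σ : Op I) :
    C.init σ = (σ ⊗ₖ Matrix.single (fun _ => false) (fun _ => false) 1).submatrix
      (splitWires C.inp) (splitWires C.inp) := by
  ext x y
  rw [Matrix.submatrix_apply, Matrix.kronecker_apply, Circuit.init, Matrix.of_apply,
    splitWires_fst, splitWires_fst, Matrix.single_apply]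
  by_cases h : ∀ w, w ∉ Set.range C.inp → x w = false ∧ y w = false
  · rw [if_pos h, if_pos ⟨funext fun w => (h w w.2).1.symm, funext fun w => (h w w.2).2.symm⟩,
      mul_one]
  · rw [if_neg h, if_neg, mul_zero]
    rintro ⟨h1, h2⟩
    exact h fun w hw => ⟨(congrFun h1 ⟨w, hw⟩).symm, (congrFun h2 ⟨w, hw⟩).symm⟩

lemma Circuit.acceptMap_measureUnitary [DecidableEq I] (C : Circuit S I Unit) (h : C.out () ∉ Set.range C.inp)
    {Q : Op I} (hQ : Q.conjTranspose = Q) (hQ2 : Q * Q = Q) (σ : Op I) :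
    C.acceptMap (C.measureUnitary h Q) σ = (Q * σ).trace := by
  change C.traceOut _ _ _ = _
  rw [C.conjTranspose_measureUnitary h hQ, C.traceOut_unit,
    ← trace_measureOp (⟨C.out (), h⟩ : {w // w ∉ Set.range C.inp}) hQ2 σ, C.init_eq_submatrix,
    Circuit.measureUnitary, Matrix.submatrix_mul_equiv, Matrix.submatrix_mul_equiv, Matrix.trace,
    ← Matrix.diagonal_one, Matrix.diagonal_kronecker_diagonal]
  refine Fintype.sum_equiv (splitWires C.inp) _ _ fun x => ?_
  rw [Matrix.diag_apply, Matrix.diagonal_mul, Matrix.submatrix_apply, splitWires_snd, one_mul,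
    ite_mul, one_mul, zero_mul]

end Measurement

/-! ### Compiling the measurement over a universal gate set. -/

section Approximation

variable {l n t : ℕ}

/-- The average of `t` copies of a Haar random state. -/
def haarAverage (t n : ℕ) : Op (Fin t × Fin n) :=
  Matrix.of fun x y => ∫ θ, copies t (PureState.proj θ) x y ∂(haarState n)

lemma integrable_copies_proj (x y : Fin t × Fin n → Bool) :
    Integrable (fun θ : PureState n => copies t θ.proj x y) (haarState n) := by
  refine Continuous.integrable_of_hasCompactSupport ?_ (HasCompactSupport.of_compactSpace _)
  simp only [copies, PureState.proj, Matrix.of_apply]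
  fun_prop

/-- Replacing the integral by one fixed operator makes continuity of the advantage in the circuit
unitary a finite-dimensional matter. -/
lemma integral_linearMap_copies (f : Op (Fin t × Fin n) →ₗ[ℂ] ℂ) :
    ∫ θ : PureState n, (f (copies t θ.proj)).re ∂(haarState n) = (f (haarAverage t n)).re := by
  have h1 : ∀ σ : Op (Fin t × Fin n), f σ = ∑ x, ∑ y, σ x y * f (Matrix.single x y 1) := by
    intro σ
    conv_lhs => rw [Matrix.matrix_eq_sum_single σ]
    rw [map_sum]
    refine Finset.sum_congr rfl fun x _ => ?_
    rw [map_sum]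
    refine Finset.sum_congr rfl fun y _ => ?_
    rw [← smul_eq_mul, ← map_smul, Matrix.smul_single, smul_eq_mul, mul_one]
  have h2 : ∀ x y, Integrable (fun θ : PureState n =>
      copies t θ.proj x y * f (Matrix.single x y 1)) (haarState n) :=
    fun x y => (integrable_copies_proj x y).mul_const _
  have h3 : Integrable (fun θ : PureState n => f (copies t θ.proj)) (haarState n) := by
    simp_rw [h1 (copies t _)]
    exact integrable_finsetSum _ fun x _ => integrable_finsetSum _ fun y _ => h2 x y
  have h4 := integral_re h3
  simp only [RCLike.re_eq_complex_re] at h4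
  rw [h4, h1 (haarAverage t n)]
  simp_rw [h1 (copies t _)]
  rw [integral_finsetSum _ fun x _ => integrable_finsetSum _ fun y _ => h2 x y]
  congr 1
  refine Finset.sum_congr rfl fun x _ => ?_
  rw [integral_finsetSum _ fun y _ => h2 x y]
  refine Finset.sum_congr rfl fun y _ => ?_
  rw [integral_mul_const]
  rfl

lemma advantage_linearMap (ρ : (Fin l → Bool) → Op (Fin n)) (f : Op (Fin t × Fin n) →ₗ[ℂ] ℂ) :
    advantage t ρ (fun σ => (f σ).re) =
      |(∑ k, (f (copies t (ρ k))).re) / 2 ^ l - (f (haarAverage t n)).re| := by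
  rw [advantage, integral_linearMap_copies]

/-- Projective measurements are implemented by circuits over a universal gate set, up to an
arbitrarily small loss of advantage. -/
theorem exists_circuit_lt_advantage {S : GateSet} (hS : S.IsUniversal)
    (ρ : (Fin l → Bool) → Op (Fin n)) {Q : Op (Fin t × Fin n)} (hQ : Q.conjTranspose = Q)
    (hQ2 : Q * Q = Q) {ε : ℝ} (hε : ε < advantage t ρ fun σ => (Q * σ).trace.re) :
    ∃ C : Circuit S (Fin t × Fin n) Unit, ε < advantage t ρ C.accept := by
  obtain ⟨m, hm, hmt⟩ := (hS.and (eventually_ge_atTop (t * n + 1))).exists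
  -- One wire per input qubit, and `none` for the output wire.
  obtain ⟨e⟩ : Nonempty (Option (Fin t × Fin n) ↪ Fin m) :=
    Function.Embedding.nonempty_of_card_le (by simpa using hmt)
  let C (gs : List (PlacedGate S m)) : Circuit S (Fin t × Fin n) Unit :=
    { m := m
      inp := Function.Embedding.some.trans e
      out := ⟨fun _ => e none, fun _ _ _ => rfl⟩
      gates := gs }
  have hout : (C []).out () ∉ Set.range (C []).inp := by
    rintro ⟨i, hi⟩
    exact Option.some_ne_none i (e.injective hi)
  let U : Op (Fin m) := (C []).measureUnitary hout Q
  let adv : Op (Fin m) → ℝ := fun W =>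
    |(∑ k, ((C []).acceptMap W (copies t (ρ k))).re) / 2 ^ l -
      ((C []).acceptMap W (haarAverage t n)).re|
  have hcont : Continuous adv := by
    refine Continuous.abs (Continuous.sub (Continuous.div_const (continuous_finsetSum _
      fun k _ => ?_) _) ?_)
    · exact Complex.continuous_re.comp ((C []).continuous_acceptMap _)
    · exact Complex.continuous_re.comp ((C []).continuous_acceptMap _)
  have hU : ε < adv U := by
    have h1 := advantage_linearMap ρ ((C []).acceptMap U)
    have h2 : ∀ σ, (C []).acceptMap U σ = (Q * σ).trace :=
      (C []).acceptMap_measureUnitary hout hQ hQ2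
    change ε < |_ - _|
    rw [← h1]
    simp_rw [h2]
    exact hε
  -- Exceeding `ε` is an open condition that holds at `U`, so some gate sequence times a phase meets
  -- it.
  obtain ⟨W, hW, gs, z, hz, rfl⟩ := mem_closure_iff.mp
    (hm U ((C []).measureUnitary_mem_unitaryGroup hout hQ hQ2)) {W | ε < adv W}
    (isOpen_lt continuous_const hcont) hU
  refine ⟨C gs, ?_⟩
  have h1 := advantage_linearMap ρ ((C []).acceptMap (gatesOp gs))
  have h2 : (C gs).accept = fun σ => ((C []).acceptMap (gatesOp gs) σ).re := rfl
  have h3 : ε < adv (z • gatesOp gs) := hW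
  rw [h2, h1]
  simp only [adv] at h3
  rwa [(C []).acceptMap_smul hz] at h3

end Approximation

/-! ### Asymptotics and assembly. -/

/-- As `2 ^ n ≥ l`, the binomial is at least `choose (2 * l - 1) l`, half a central binomial
coefficient. With `t = l` it thus outgrows the `2 ^ l` keys. -/
lemma four_pow_le_mul_choose {l n : ℕ} (hl : 4 ≤ l) (hn : Real.logb 2 (l : ℝ) ≤ (n : ℝ)) :
    4 ^ l ≤ 2 * l * (2 ^ n + l - 1).choose l := by
  have h1 : l ≤ 2 ^ n := by
    have hl0 : (0 : ℝ) < l := by exact_mod_cast (by omega : 0 < l)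
    rw [Real.logb_le_iff_le_rpow one_lt_two hl0, Real.rpow_natCast] at hn
    exact_mod_cast hn
  have h2 : (2 * l - 1).choose l ≤ (2 ^ n + l - 1).choose l := Nat.choose_le_choose l (by omega)
  have h3 : l.centralBinom = 2 * (2 * l - 1).choose l := by
    obtain ⟨s, rfl⟩ : ∃ s, l = s + 1 := ⟨l - 1, by omega⟩
    rw [Nat.centralBinom_eq_two_mul_choose]
    have e : 2 * (s + 1) = 2 * s + 1 + 1 := by ring
    rw [e, Nat.add_sub_cancel, Nat.choose_succ_succ,
      Nat.choose_symm_of_eq_add (by ring : 2 * s + 1 = s + (s + 1))]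
    ring
  calc 4 ^ l ≤ l * l.centralBinom := (Nat.four_pow_lt_mul_centralBinom l hl).le
    _ = 2 * l * (2 * l - 1).choose l := by rw [h3]; ring
    _ ≤ _ := Nat.mul_le_mul_left _ h2

/-- The advantage of the ideal distinguisher exceeds `1 / 3` once `l` is large. -/
lemma eventually_one_third_lt {n : ℕ → ℕ} (hn : ∀ l : ℕ, Real.logb 2 (l : ℝ) ≤ (n l : ℝ)) :
    ∀ᶠ l : ℕ in atTop, 1 / 3 < 1 / 2 - (1 / 2 : ℝ) ^ l -
      √(2 ^ l * (1 / ((2 ^ n l + l - 1).choose l : ℝ))) := by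
  have h1 : Tendsto (fun l : ℕ => (1 / 2 : ℝ) ^ l) atTop (nhds 0) :=
    tendsto_pow_atTop_nhds_zero_of_lt_one (by norm_num) (by norm_num)
  have h2 : Tendsto (fun l : ℕ => (l : ℝ) * (1 / 2 : ℝ) ^ l) atTop (nhds 0) :=
    tendsto_self_mul_const_pow_of_lt_one (by norm_num) (by norm_num)
  have h3 : Tendsto (fun l : ℕ => 1 / 2 - (1 / 2 : ℝ) ^ l - √(2 * ((l : ℝ) * (1 / 2 : ℝ) ^ l)))
      atTop (nhds (1 / 2 - 0 - √(2 * 0))) :=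
    (tendsto_const_nhds.sub h1).sub ((h2.const_mul 2).sqrt)
  have h4 : (1 / 3 : ℝ) < 1 / 2 - 0 - √(2 * 0) := by
    rw [mul_zero, Real.sqrt_zero]; norm_num
  filter_upwards [h3.eventually_const_lt h4, eventually_ge_atTop 4] with l hl hl4
  refine hl.trans_le (sub_le_sub_left (Real.sqrt_le_sqrt ?_) _)
  have h5 : (4 : ℝ) ^ l ≤ 2 * l * ((2 ^ n l + l - 1).choose l : ℝ) := by
    exact_mod_cast four_pow_le_mul_choose hl4 (hn l)
  have h6 : (0 : ℝ) < ((2 ^ n l + l - 1).choose l : ℝ) := by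
    have : 0 < 2 ^ n l := by positivity
    exact_mod_cast Nat.choose_pos (by omega)
  have h7 : (4 : ℝ) ^ l = 2 ^ l * 2 ^ l := by rw [← mul_pow]; norm_num
  rw [mul_one_div, one_div, inv_pow, ← mul_assoc, ← div_eq_mul_inv,
    div_le_div_iff₀ h6 (by positivity), ← h7]
  exact h5

/-- Every keyed family of mixed states is distinguished from Haar random states. -/
theorem exists_distinguisher {S : GateSet} (hS : S.IsUniversal) {n : ℕ → ℕ}
    (hn : ∀ l : ℕ, Real.logb 2 (l : ℝ) ≤ (n l : ℝ))
    (ρ : (l : ℕ) → (Fin l → Bool) → DensityMatrix (n l)) :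
    ∃ (t : Polynomial ℕ) (A : (l : ℕ) → Circuit S (Fin (t.eval l) × Fin (n l)) Unit),
      ∀ᶠ l : ℕ in atTop, 1 / 3 ≤ advantage (t.eval l) (fun k => (ρ l k).1) (A l).accept := by
  refine ⟨Polynomial.X, ?_⟩
  have key : ∀ l : ℕ, ∃ C : Circuit S (Fin (Polynomial.X.eval l) × Fin (n l)) Unit, 0 < l →
      1 / 3 < 1 / 2 - (1 / 2 : ℝ) ^ l - √(2 ^ l * (1 / ((2 ^ n l + l - 1).choose l : ℝ))) →
      1 / 3 ≤ advantage (Polynomial.X.eval l) (fun k => (ρ l k).1) C.accept := by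
    intro l
    rw [Polynomial.eval_X]
    by_cases h : 0 < l ∧
      1 / 3 < 1 / 2 - (1 / 2 : ℝ) ^ l - √(2 ^ l * (1 / ((2 ^ n l + l - 1).choose l : ℝ)))
    · obtain ⟨hl, hb⟩ := h
      obtain ⟨Q, hQ, hQ2, hρ, hH⟩ := exists_distinguishing_projection hl (ρ l)
      have hadv : 1 / 3 < advantage l (fun k => (ρ l k).1) fun σ => (Q * σ).trace.re := by
        refine hb.trans_le (le_trans ?_ (le_abs_self _))
        refine sub_le_sub ?_ hH
        rw [le_div_iff₀ (by positivity)]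
        have h1 := Finset.sum_le_sum fun k (_ : k ∈ Finset.univ) => hρ k
        simp only [Finset.sum_const, Finset.card_univ, Fintype.card_fun, Fintype.card_bool,
          Fintype.card_fin, nsmul_eq_mul, Nat.cast_pow, Nat.cast_ofNat] at h1
        linarith
      obtain ⟨C, hC⟩ := exists_circuit_lt_advantage hS _ hQ hQ2 hadv
      exact ⟨C, fun _ _ => hC.le⟩
    -- Below the threshold any circuit will do; the zero projection supplies one.
    · obtain ⟨C, -⟩ := exists_circuit_lt_advantage (t := l) hS (fun k => (ρ l k).1) (Q := 0)
        Matrix.conjTranspose_zero (mul_zero 0) (sub_one_lt _)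
      exact ⟨C, fun h1 h2 => absurd ⟨h1, h2⟩ h⟩
  choose A hA using key
  refine ⟨A, ?_⟩
  filter_upwards [eventually_one_third_lt hn, eventually_gt_atTop 0] with l h1 h2
  exact hA l h2 h1

open scoped ComplexOrder in
/-- The density matrix of a pure state. -/
def PureState.toDensityMatrix {n : ℕ} (ψ : PureState n) : DensityMatrix n :=
  ⟨ψ.proj, Matrix.posSemidef_vecMulVec_self_star ψ.1.ofLp, by
    have h1 : ‖ψ.1‖ = 1 := by simp
    change (Matrix.vecMulVec ψ.1.ofLp (star ψ.1.ofLp)).trace = 1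
    rw [Matrix.trace_vecMulVec, ← EuclideanSpace.inner_eq_star_dotProduct,
      inner_self_eq_norm_sq_to_K, h1]
    simp⟩

end PRS

end

theorem mainTheorem3 (S : PRS.GateSet) (hS : S.IsUniversal) (n : ℕ → ℕ)
    (hn : ∀ l : ℕ, Real.logb 2 (l : ℝ) ≤ (n l : ℝ)) :
    -- every PRS generator with output length `n`
    (∀ G : (l : ℕ) → PRS.Circuit S (Fin l) (Fin (n l)), PRS.IsPRSGenerator n G →
      ∃ (t : Polynomial ℕ) (A : (l : ℕ) → PRS.Circuit S (Fin (t.eval l) × Fin (n l)) Unit),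
        ∀ᶠ l : ℕ in Filter.atTop,
          1 / 3 ≤ PRS.advantage (t.eval l) (fun k => (G l).run (PRS.basisState k)) (A l).accept) ∧
    -- more generally every keyed family of possibly mixed states, efficient and secure or not
    (∀ ρ : (l : ℕ) → (Fin l → Bool) → PRS.DensityMatrix (n l),
      ∃ (t : Polynomial ℕ) (A : (l : ℕ) → PRS.Circuit S (Fin (t.eval l) × Fin (n l)) Unit),
        ∀ᶠ l : ℕ in Filter.atTop,
          1 / 3 ≤ PRS.advantage (t.eval l) (fun k => (ρ l k).1) (A l).accept) ∧
    -- in particular no such family is secure against unbounded distinguishers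
    (∀ ρ : (l : ℕ) → (Fin l → Bool) → PRS.DensityMatrix (n l),
      ¬ PRS.IsStatisticallyPseudorandom S n ρ) := by
  have general := fun ρ => PRS.exists_distinguisher hS hn ρ
  refine ⟨fun G hG => ?_, general, fun ρ hρ => ?_⟩
  · choose ψ hψ using hG.stateGeneration
    obtain ⟨t, A, hA⟩ := general fun l k => (ψ l k).toDensityMatrix
    refine ⟨t, A, hA.mono fun l hl => ?_⟩
    have h : (fun k => (G l).run (PRS.basisState k)) =
        fun k => (ψ l k).toDensityMatrix.1 := funext (hψ l)
    rwa [h]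
  · obtain ⟨t, A, hA⟩ := general ρ
    obtain ⟨ε, hε, hle⟩ := hρ t A
    -- Superpolynomial decay at exponent zero is convergence to zero.
    have h0 : Filter.Tendsto ε Filter.atTop (nhds 0) := by simpa using hε 0
    obtain ⟨l, h1, h2⟩ :=
      (hA.and (h0.eventually_lt_const (by norm_num : (0 : ℝ) < 1 / 3))).exists
    exact absurd (h1.trans (hle l)) (not_le.mpr h2)
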